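/- Let $n\ge 1$, $\tau\ge 0$ be integers and let $A^{l}(k)=[a^{l}_{ij}(k)]$ ($0\le l\le\tau$, $k=0,1,2,\dots$) be random real $n\times n$ matrices on a common probability space such that, almost surely, for all $k,l,i,j$: $a^{l}_{ij}(k)\ge 0$, $\sum_{l=0}^{\tau}\sum_{j=1}^{n}a^{l}_{ij}(k)=1$ for each $i$, and $a^{l}_{jj}(k)=0$ for $1\le l\le\tau$. Consider the delayed system $$x_i(k+1)=\sum_{l=0}^{\tau}\sum_{j=1}^{n}a^{l}_{ij}(k)\,x_j(k-l),\qquad i=1,\dots,n,\ k=0,1,2,\dots,$$ with arbitrary initial data $x(-\tau),\dots,x(0)\in\mathbb{R}^n$, and put $B(k)=\sum_{l=0}^{\tau}A^{l}(k)$. A nonnegative $n\times n$ matrix $M=[m_{ij}]$ is said to have a $\delta$-spanning tree ($\delta>0$) if the directed graph on $\{1,\dots,n\}$ with an edge from $j$ to $i$ exactly when $m_{ij}\ge\delta$ contains a spanning directed tree, i.e. a spanning subgraph with a root that has no in-neighbour, in which every other vertex has exactly one in-neighbour and is reached from the root by a directed path. Suppose that there is $\delta>0$ such that almost surely $A^{0}(k)\ge\delta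 I$ entrywise for all $k$, that there is an integer $N>0$ such that the families $(A^{0}(k),\dots,A^{\tau}(k))$ and $(A^{0}(k'),\dots,A^{\tau}(k'))$ are independent whenever $k'\ge k+N$, and that there is an integer $h>0$ such that for every $m\ge 0$ the matrix $\sum_{k=m+1}^{m+h}\mathbb{E}B(k)$ has a $\delta$-spanning tree. Then the system reaches consensus almost surely: with probability one, for all initial data there is $c\in\mathbb{R}$ with $\lim_{k\to\infty}x_i(k)=c$ for every $i=1,\dots,n$. -/

import Mathlib

open MeasureTheory ProbabilityTheory Filter Topology

namespace DelayedConsensus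

/-- The directed graph of a (nonnegative) weight matrix `A`: there is an edge from `j` to `i`
exactly when `A i j > 0`. -/
def graphOf {n : ℕ} (A : Matrix (Fin n) (Fin n) ℝ) : Digraph (Fin n) where
  Adj j i := 0 < A i j

/-- The `δ`-matrix of `A`: keep the entries that are at least `δ`, replace all others by `0`. -/
noncomputable def deltaMatrix {n : ℕ} (δ : ℝ) (A : Matrix (Fin n) (Fin n) ℝ) :
    Matrix (Fin n) (Fin n) ℝ :=
  Matrix.of fun i j => if δ ≤ A i j then A i j else 0

/-- A directed tree: there is a root without in-neighbours, every other vertex has exactly one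
in-neighbour, and every other vertex is reached from the root by a directed path. -/
def IsDirectedTree {V : Type*} (T : Digraph V) : Prop :=
  ∃ r : V, (∀ u, ¬ T.Adj u r) ∧ (∀ v, v ≠ r → ∃! u, T.Adj u v) ∧
    ∀ v, v ≠ r → Relation.TransGen T.Adj r v

/-- `G` has a spanning tree: some spanning subgraph of `G` is a directed tree. -/
def HasSpanningTree {V : Type*} (G : Digraph V) : Prop :=
  ∃ T : Digraph V, T ≤ G ∧ IsDirectedTree T

/-- The matrix `A` has a `δ`-spanning tree: the graph of its `δ`-matrix has a spanning tree. -/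
def HasDeltaSpanningTree {n : ℕ} (δ : ℝ) (A : Matrix (Fin n) (Fin n) ℝ) : Prop :=
  HasSpanningTree (graphOf (deltaMatrix δ A))

/-- `x` is a trajectory of the delayed system with coefficients `a l k = A^l(k)`:
`x_i(k+1) = ∑_{l=0}^τ ∑_j a^l_{ij}(k) x_j(k-l)` for every time `k ≥ 0`. The initial data are the
values `x(-τ), …, x(0)`. -/
def IsTrajectory {n τ : ℕ} (a : Fin (τ + 1) → ℕ → Matrix (Fin n) (Fin n) ℝ)
    (x : ℤ → Fin n → ℝ) : Prop :=
  ∀ (k : ℕ) (i : Fin n), x ((k : ℤ) + 1) i = ∑ l, ∑ j, a l k i j * x ((k : ℤ) - (l : ℕ)) j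

/-- The system reaches consensus: along every trajectory all the components converge to a common
limit. -/
def ReachesConsensus {n τ : ℕ} (a : Fin (τ + 1) → ℕ → Matrix (Fin n) (Fin n) ℝ) : Prop :=
  ∀ x : ℤ → Fin n → ℝ, IsTrajectory a x →
    ∃ c : ℝ, ∀ i, Tendsto (fun k : ℕ => x (k : ℤ) i) atTop (𝓝 c)

/-- `B(k) = ∑_{l=0}^τ A^l(k)`. -/
def totalMatrix {n τ : ℕ} (a : Fin (τ + 1) → ℕ → Matrix (Fin n) (Fin n) ℝ) (k : ℕ) :
    Matrix (Fin n) (Fin n) ℝ :=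
  ∑ l, a l k

/-- The entrywise expectation of a random matrix. -/
noncomputable def expectedMatrix {Ω : Type*} [MeasurableSpace Ω] {n : ℕ} (μ : Measure Ω)
    (M : Ω → Matrix (Fin n) (Fin n) ℝ) : Matrix (Fin n) (Fin n) ℝ :=
  Matrix.of fun i j => ∫ ω, M ω i j ∂μ

end DelayedConsensus

namespace DelayedConsensus

variable {n τ : ℕ}

/-! Only cuts matter: a `δ`-spanning tree yields a root `r` such that every proper vertex set
containing `r` sends out an entry at least `δ`. If every such cut carries total weight at least 1
over a window, a lower bound known on a set containing `r` spreads to one more vertex at the cost of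
a fixed factor: the cut has a heavy edge, and `A⁰ ≥ δ I` keeps gained values alive. Among `n * n`
good windows, `n` share a root, so that root influences every vertex and the range of any trajectory
contracts by a fixed factor (`contract`). Infinitely many such superwindows force consensus.

Probability supplies them. For a suitable root, the expected weight of each cut grows linearly with
the window length, and by independence at lag `N` the variance grows at most linearly; Chebyshev and
a union bound over cuts make long windows good with probability near 1
(`exists_measure_not_isGoodWindow_le`). Reverse Fatou then gives, for each `ε`, infinitely many good
superwindows of some fixed length with probability at least `1 - ε`
(`ae_frequently_isGoodSuperwindow`). -/

/-- The total weight of the edges of `∑ₗ a l k` that lead from `S` to its complement. -/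
def cutWeight (a : Fin (τ + 1) → ℕ → Matrix (Fin n) (Fin n) ℝ) (S : Finset (Fin n)) (k : ℕ) : ℝ :=
  ∑ i ∈ Sᶜ, ∑ j ∈ S, ∑ l, a l k i j

/-- Some vertex `r` is such that every proper vertex set containing `r` sends out at least one unit
of weight during the times `s + 1, …, t`. -/
def IsGoodWindow (a : Fin (τ + 1) → ℕ → Matrix (Fin n) (Fin n) ℝ) (s t : ℕ) : Prop :=
  ∃ r, ∀ S : Finset (Fin n), r ∈ S → S ≠ Finset.univ →
    1 ≤ ∑ k ∈ Finset.Ioc s t, cutWeight a S k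

/-- The pointwise assumptions on the coefficients of the delayed system. -/
structure IsStochastic (δ : ℝ) (a : Fin (τ + 1) → ℕ → Matrix (Fin n) (Fin n) ℝ) : Prop where
  nonneg : ∀ l k i j, 0 ≤ a l k i j
  sum_eq_one : ∀ k i, ∑ l, ∑ j, a l k i j = 1
  le_diag : ∀ k i, δ ≤ a 0 k i i

/-- The delayed recursion for a trajectory whose time has been shifted by `τ`. -/
def IsShiftedTrajectory (a : Fin (τ + 1) → ℕ → Matrix (Fin n) (Fin n) ℝ)
    (u : ℕ → Fin n → ℝ) : Prop :=
  ∀ k i, u (k + τ + 1) i = ∑ l : Fin (τ + 1), ∑ j, a l k i j * u (k + τ - l) j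

/-- Otherwise `S`, which contains the root, would be closed under tree edges and hence contain every
vertex. -/
theorem HasDeltaSpanningTree.exists_root {δ : ℝ} {M : Matrix (Fin n) (Fin n) ℝ}
    (h : HasDeltaSpanningTree δ M) :
    ∃ r, ∀ S : Finset (Fin n), r ∈ S → S ≠ Finset.univ → ∃ j ∈ S, ∃ i ∉ S, δ ≤ M i j := by
  obtain ⟨T, hT, r, -, -, hr⟩ := h
  refine ⟨r, fun S hS hne => ?_⟩
  by_contra! hcon
  refine hne (Finset.eq_univ_iff_forall.2 fun v => ?_)
  by_cases hv : v = r
  · exact hv ▸ hS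
  have step : ∀ u w, T.Adj u w → u ∈ S → w ∈ S := by
    intro u w huw hu
    by_contra hw
    have h1 : 0 < deltaMatrix δ M w u := hT huw
    have h2 := hcon u hu w hw
    simp [deltaMatrix, not_le.2 h2] at h1
  have := hr v hv
  induction this with
  | single h => exact step _ _ h hS
  | @tail b c _ h ih =>
    by_cases hb : b = r
    · exact step _ _ h (hb ▸ hS)
    · exact step _ _ h (ih hb)

/-! ### Order preservation and persistence for the delayed recursion -/

namespace IsShiftedTrajectory

variable {a : Fin (τ + 1) → ℕ → Matrix (Fin n) (Fin n) ℝ} {u : ℕ → Fin n → ℝ} {δ : ℝ}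

theorem neg (hu : IsShiftedTrajectory a u) : IsShiftedTrajectory a (-u) := by
  intro k i
  simp [hu k i, Finset.sum_neg_distrib]

theorem sub_eq (hu : IsShiftedTrajectory a u) (ha : IsStochastic δ a) (b : ℝ) (k : ℕ) (i : Fin n) :
    u (k + τ + 1) i - b = ∑ l : Fin (τ + 1), ∑ j, a l k i j * (u (k + τ - l) j - b) := by
  simp only [mul_sub, Finset.sum_sub_distrib, ← Finset.sum_mul]
  rw [ha.sum_eq_one, hu k i, one_mul]

/-- Each new value is a convex combination of the last `τ + 1` levels. -/
theorem lower_bound (hu : IsShiftedTrajectory a u) (ha : IsStochastic δ a) {b : ℝ} {t : ℕ}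
    (h : ∀ p, t ≤ p → p ≤ t + τ → ∀ i, b ≤ u p i) : ∀ p, t ≤ p → ∀ i, b ≤ u p i := by
  intro p
  induction p using Nat.strong_induction_on with
  | _ p ih =>
    intro hp i
    by_cases hpt : p ≤ t + τ
    · exact h p hp hpt i
    obtain ⟨k, rfl⟩ : ∃ k, p = k + τ + 1 := ⟨p - τ - 1, by omega⟩
    have := hu.sub_eq ha b k i
    have h0 : 0 ≤ u (k + τ + 1) i - b := by
      rw [this]
      refine Finset.sum_nonneg fun l _ => Finset.sum_nonneg fun j _ =>
        mul_nonneg (ha.nonneg _ _ _ _) (sub_nonneg.2 (ih _ ?_ ?_ j))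
      · omega
      · omega
    linarith

theorem mul_le_step (hu : IsShiftedTrajectory a u) (ha : IsStochastic δ a) {b : ℝ} {t : ℕ}
    (h : ∀ p, t ≤ p → ∀ i, b ≤ u p i) {k : ℕ} (hk : t ≤ k) (l : Fin (τ + 1)) (i j : Fin n) :
    a l k i j * (u (k + τ - l) j - b) ≤ u (k + τ + 1) i - b := by
  rw [hu.sub_eq ha b k i]
  have hn : ∀ (l : Fin (τ + 1)) (j), 0 ≤ a l k i j * (u (k + τ - l) j - b) := fun l j =>
    mul_nonneg (ha.nonneg _ _ _ _) (sub_nonneg.2 (h _ (by omega) j))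
  exact (Finset.single_le_sum (fun j _ => hn l j) (Finset.mem_univ j)).trans
    (Finset.single_le_sum (f := fun l : Fin (τ + 1) => ∑ j, a l k i j * (u (k + τ - l) j - b))
      (fun l _ => Finset.sum_nonneg fun j _ => hn l j) (Finset.mem_univ l))

/-- The self-weight retains a factor `δ` of the excess over `b` at each step. Starting from `t + τ`
keeps every delayed value in the range where `b` is a lower bound. -/
theorem persist (hu : IsShiftedTrajectory a u) (ha : IsStochastic δ a) (hδ : 0 < δ) {b : ℝ} {t : ℕ}
    (h : ∀ p, t ≤ p → ∀ i, b ≤ u p i) {p : ℕ} (hp : t + τ ≤ p) (i : Fin n) (d : ℕ) :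
    δ ^ d * (u p i - b) ≤ u (p + d) i - b := by
  induction d with
  | zero => simp
  | succ d ih =>
    have h1 := hu.mul_le_step ha h (k := p + d - τ) (by omega) 0 i i
    have e1 : p + d - τ + τ - ((0 : Fin (τ + 1)) : ℕ) = p + d := by simp; omega
    have e2 : p + d - τ + τ + 1 = p + (d + 1) := by omega
    rw [e1, e2] at h1
    have h2 : 0 ≤ u (p + d) i - b := sub_nonneg.2 (h _ (by omega) i)
    calc δ ^ (d + 1) * (u p i - b) = δ * (δ ^ d * (u p i - b)) := by ring
      _ ≤ δ * (u (p + d) i - b) := by gcongr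
      _ ≤ a 0 (p + d - τ) i i * (u (p + d) i - b) := by gcongr; exact ha.le_diag _ _
      _ ≤ _ := h1

end IsShiftedTrajectory

theorem IsStochastic.delta_le_one {a : Fin (τ + 1) → ℕ → Matrix (Fin n) (Fin n) ℝ} {δ : ℝ}
    (ha : IsStochastic δ a) (i : Fin n) : δ ≤ 1 := by
  rw [← ha.sum_eq_one 0 i]
  refine (ha.le_diag 0 i).trans ?_
  exact (Finset.single_le_sum (f := fun j => a 0 0 i j) (fun j _ => ha.nonneg 0 0 i j)
      (Finset.mem_univ i)).trans
    (Finset.single_le_sum (f := fun l => ∑ j, a l 0 i j)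
      (fun l _ => Finset.sum_nonneg fun j _ => ha.nonneg l 0 i j) (Finset.mem_univ 0))

/-- If the cut weight of a window is at least one, some single edge of the cut is not too light. -/
theorem exists_heavy_edge {a : Fin (τ + 1) → ℕ → Matrix (Fin n) (Fin n) ℝ} {S : Finset (Fin n)}
    {t L : ℕ} (h : 1 ≤ ∑ k ∈ Finset.Ioc t (t + L), cutWeight a S k) :
    ∃ k ∈ Finset.Ioc t (t + L), ∃ i ∉ S, ∃ j ∈ S, ∃ l,
      1 / ((L + 1) * (n + 1) * (n + 1) * (τ + 1) : ℝ) ≤ a l k i j := by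
  by_contra! hcon
  set η : ℝ := 1 / ((L + 1) * (n + 1) * (n + 1) * (τ + 1) : ℝ) with hη
  have hη0 : 0 < η := by positivity
  have hc : ∀ S : Finset (Fin n), (S.card : ℝ) ≤ n := fun S => by
    exact_mod_cast (Finset.card_le_univ S).trans_eq (Fintype.card_fin n)
  have h1 : ∑ k ∈ Finset.Ioc t (t + L), cutWeight a S k ≤
      ∑ k ∈ Finset.Ioc t (t + L), ∑ i ∈ Sᶜ, ∑ j ∈ S, ∑ l : Fin (τ + 1), η := by
    refine Finset.sum_le_sum fun k hk => Finset.sum_le_sum fun i hi => Finset.sum_le_sum fun j hj =>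
      Finset.sum_le_sum fun l _ => (hcon k hk i (Finset.mem_compl.1 hi) j hj l).le
  have h2 : ∑ k ∈ Finset.Ioc t (t + L), ∑ i ∈ Sᶜ, ∑ j ∈ S, ∑ l : Fin (τ + 1), η
      ≤ L * (n * (n * ((τ + 1) * η))) := by
    simp only [Finset.sum_const, nsmul_eq_mul, Nat.card_Ioc, Finset.card_univ, Fintype.card_fin]
    have := hc S
    have := hc Sᶜ
    rw [Nat.add_sub_cancel_left]
    push_cast
    gcongr
  -- The `+ 1`s in `η` supply the strictness and avoid division by zero.
  have h3 : (L : ℝ) * (n * (n * ((τ + 1) * η))) < 1 := by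
    have : (1 : ℝ) = (L + 1) * ((n + 1) * ((n + 1) * ((τ + 1) * η))) := by
      rw [hη]; field_simp
    rw [this]
    have hx : 0 ≤ (n * (n * ((τ + 1) * η)) : ℝ) := by positivity
    have hy : (n * (n * ((τ + 1) * η)) : ℝ) ≤ (n + 1) * ((n + 1) * ((τ + 1) * η)) := by
      gcongr <;> linarith
    have hz : 0 < ((n + 1) * ((n + 1) * ((τ + 1) * η)) : ℝ) := by positivity
    nlinarith [Nat.cast_nonneg (α := ℝ) L]
  linarith

/-! ### Spreading over a superwindow, contraction and consensus -/

/-- `n * n` consecutive good windows of length `L`, separated by gaps of length `τ + 1`. -/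
def IsGoodSuperwindow (a : Fin (τ + 1) → ℕ → Matrix (Fin n) (Fin n) ℝ) (L s : ℕ) : Prop :=
  ∀ q < n * n, IsGoodWindow a (s + q * (L + τ + 1)) (s + q * (L + τ + 1) + L)

/-- The factor by which a lower bound deteriorates while it spreads along one edge. -/
noncomputable def spreadRate (δ : ℝ) (n τ L : ℕ) : ℝ :=
  1 / ((L + 1) * (n + 1) * (n + 1) * (τ + 1) : ℝ) * δ ^ (L + 2 * τ + 1) * δ ^ (L + 2 * τ + 1)

theorem spreadRate_pos {δ : ℝ} (hδ : 0 < δ) (n τ L : ℕ) : 0 < spreadRate δ n τ L := by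
  unfold spreadRate; positivity

theorem one_div_edges_le_one (n τ L : ℕ) :
    1 / ((L + 1) * (n + 1) * (n + 1) * (τ + 1) : ℝ) ≤ 1 := by
  rw [div_le_one (by positivity)]
  have : 1 ≤ (L + 1) * (n + 1) * (n + 1) * (τ + 1) := Nat.one_le_iff_ne_zero.2 (by positivity)
  exact_mod_cast this

theorem spreadRate_le_pow {δ : ℝ} (hδ : 0 < δ) (hδ1 : δ ≤ 1) (n τ L : ℕ) :
    spreadRate δ n τ L ≤ δ ^ (L + 2 * τ + 1) := by
  unfold spreadRate
  have h1 : 1 / ((L + 1) * (n + 1) * (n + 1) * (τ + 1) : ℝ) * δ ^ (L + 2 * τ + 1) ≤ 1 :=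
    mul_le_one₀ (one_div_edges_le_one n τ L) (by positivity) (pow_le_one₀ hδ.le hδ1)
  exact mul_le_of_le_one_left (by positivity) h1

section Spread

variable {a : Fin (τ + 1) → ℕ → Matrix (Fin n) (Fin n) ℝ} {u : ℕ → Fin n → ℝ} {δ : ℝ}

theorem IsShiftedTrajectory.persist_of_le (hu : IsShiftedTrajectory a u) (ha : IsStochastic δ a)
    (hδ : 0 < δ) {b : ℝ} {s : ℕ} (h : ∀ p, s ≤ p → ∀ i, b ≤ u p i) {t p D : ℕ} (ht : s + τ ≤ t)
    (htp : t ≤ p) (hpD : p ≤ t + D) {i : Fin n} {w : ℝ} (hw : 0 ≤ w) (hi : w ≤ u t i - b) :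
    δ ^ D * w ≤ u p i - b := by
  obtain ⟨d, rfl⟩ := Nat.exists_eq_add_of_le htp
  calc δ ^ D * w ≤ δ ^ d * w := by
        gcongr ?_ * w
        exact pow_le_pow_of_le_one hδ.le (ha.delta_le_one i) (by omega)
    _ ≤ δ ^ d * (u t i - b) := by gcongr
    _ ≤ _ := hu.persist ha hδ h ht i d

theorem IsShiftedTrajectory.spread_old (hu : IsShiftedTrajectory a u) (ha : IsStochastic δ a)
    (hδ : 0 < δ) {b : ℝ} {s : ℕ} (h : ∀ p, s ≤ p → ∀ i, b ≤ u p i) {t L : ℕ} (ht : s + τ ≤ t)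
    {w : ℝ} (hw : 0 ≤ w) {j : Fin n} (hj : w ≤ u t j - b) {p : ℕ} (hp : t ≤ p)
    (hp' : p ≤ t + (L + τ + 1) + τ) : spreadRate δ n τ L * w ≤ u p j - b := by
  refine le_trans ?_ (hu.persist_of_le ha hδ h ht hp (D := L + 2 * τ + 1) (by omega) hw hj)
  gcongr
  exact spreadRate_le_pow hδ (ha.delta_le_one j) n τ L

/-- The excess at `j` survives until the edge uses it, passes to `i`, and survives there until `p`;
each survival lasts at most `L + 2 * τ + 1` steps. The gap `τ + 1` ensures that the update of `i`,
at time `k + τ + 1`, is no later than `p`. -/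
theorem IsShiftedTrajectory.spread_new (hu : IsShiftedTrajectory a u) (ha : IsStochastic δ a)
    (hδ : 0 < δ) {b : ℝ} {s : ℕ} (h : ∀ p, s ≤ p → ∀ i, b ≤ u p i) {t L : ℕ} (ht : s + τ ≤ t)
    {w : ℝ} (hw : 0 ≤ w) {i j : Fin n} (hj : w ≤ u t j - b) {k : ℕ} (hk : k ∈ Finset.Ioc t (t + L))
    {l : Fin (τ + 1)} (he : 1 / ((L + 1) * (n + 1) * (n + 1) * (τ + 1) : ℝ) ≤ a l k i j)
    {p : ℕ} (hp : t + (L + τ + 1) ≤ p) (hp' : p ≤ t + (L + τ + 1) + τ) :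
    spreadRate δ n τ L * w ≤ u p i - b := by
  rw [Finset.mem_Ioc] at hk
  have h1 := hu.persist_of_le ha hδ h ht (p := k + τ - l) (D := L + 2 * τ + 1) (by omega)
    (by omega) hw hj
  have h2 := hu.mul_le_step ha h (k := k) (by omega) l i j
  set η : ℝ := 1 / ((L + 1) * (n + 1) * (n + 1) * (τ + 1) : ℝ) with hη
  have hη0 : 0 < η := by positivity
  have h3 : η * (δ ^ (L + 2 * τ + 1) * w) ≤ u (k + τ + 1) i - b :=
    (mul_le_mul he h1 (by positivity) (ha.nonneg _ _ _ _)).trans h2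
  have h4 := hu.persist_of_le ha hδ h (t := k + τ + 1) (p := p) (D := L + 2 * τ + 1) (by omega)
    (by omega) (by omega) (by positivity) h3
  refine le_of_eq_of_le ?_ h4
  rw [spreadRate, ← hη]
  ring

/-- After `n * n` good windows, the value of a suitable vertex has influenced all vertices. -/
theorem IsGoodSuperwindow.exists_root {L s : ℕ} (hg : IsGoodSuperwindow a L (s + τ)) (hn : 0 < n)
    (ha : IsStochastic δ a) (hδ : 0 < δ) :
    ∃ r, ∀ u, IsShiftedTrajectory a u → ∀ b m, (∀ p, s ≤ p → ∀ i, b ≤ u p i) → 0 ≤ m →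
      m ≤ u (s + τ) r - b → ∀ p, s + τ + n * n * (L + τ + 1) ≤ p →
        p ≤ s + τ + n * n * (L + τ + 1) + τ → ∀ i,
          spreadRate δ n τ L ^ (n * n) * (δ ^ τ * m) ≤ u p i - b := by
  have : ∀ q, ∃ r, q < n * n → ∀ S : Finset (Fin n), r ∈ S → S ≠ Finset.univ →
      1 ≤ ∑ k ∈ Finset.Ioc (s + τ + q * (L + τ + 1)) (s + τ + q * (L + τ + 1) + L),
        cutWeight a S k := by
    intro q
    by_cases hq : q < n * n
    · exact (hg q hq).imp fun r hr _ => hr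
    · exact ⟨⟨0, hn⟩, fun h => absurd h hq⟩
  choose ρ hρ using this
  -- Pigeonhole: `n * n` windows and `n` possible roots, so some `r` serves at least `n` windows.
  obtain ⟨r, -, hr⟩ := Finset.exists_le_card_fiber_of_mul_le_card_of_maps_to
    (s := Finset.range (n * n)) (t := Finset.univ) (f := ρ) (n := n)
    (fun _ _ => Finset.mem_univ _) ⟨⟨0, hn⟩, Finset.mem_univ _⟩ (by simp)
  refine ⟨r, fun u hu b m hb hm hmr => ?_⟩
  set κ := spreadRate δ n τ L with hκ
  have hκ0 : 0 < κ := spreadRate_pos hδ n τ L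
  -- The influenced set gains a vertex in each window rooted at `r` and merely persists in the
  -- others. The bound covers `τ + 1` consecutive times, as `lower_bound` will require.
  have key : ∀ q ≤ n * n, ∃ S : Finset (Fin n), r ∈ S ∧
      (S = Finset.univ ∨ 1 + ((Finset.range q).filter fun x => ρ x = r).card ≤ S.card) ∧
      ∀ j ∈ S, ∀ p, s + τ + q * (L + τ + 1) ≤ p → p ≤ s + τ + q * (L + τ + 1) + τ →
        κ ^ q * (δ ^ τ * m) ≤ u p j - b := by
    intro q
    induction q with
    | zero =>
      intro _
      refine ⟨{r}, by simp, Or.inr (by simp), ?_⟩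
      intro j hj p hp hp'
      rw [Finset.mem_singleton.1 hj, pow_zero, one_mul]
      exact hu.persist_of_le ha hδ hb le_rfl (by omega) (by omega) hm hmr
    | succ q ih =>
      intro hq
      obtain ⟨S, hrS, hcard, hS⟩ := ih (by omega)
      have e : s + τ + (q + 1) * (L + τ + 1) = s + τ + q * (L + τ + 1) + (L + τ + 1) := by ring
      have hw : 0 ≤ κ ^ q * (δ ^ τ * m) := by positivity
      have hold : ∀ j ∈ S, ∀ p, s + τ + (q + 1) * (L + τ + 1) ≤ p →
          p ≤ s + τ + (q + 1) * (L + τ + 1) + τ → κ ^ (q + 1) * (δ ^ τ * m) ≤ u p j - b := by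
        intro j hj p hp hp'
        rw [e] at hp hp'
        have := hu.spread_old ha hδ hb (L := L) (t := s + τ + q * (L + τ + 1)) (by omega) hw
          (hS j hj _ le_rfl (by omega)) (p := p) (by omega) hp'
        rw [pow_succ', mul_assoc]
        exact this
      by_cases hSu : S = Finset.univ
      · exact ⟨S, hrS, Or.inl hSu, hold⟩
      have hcard := hcard.resolve_left hSu
      by_cases hqr : ρ q = r
      · obtain ⟨k, hk, i, hi, j, hj, l, he⟩ :=
          exists_heavy_edge (hρ q (by omega) S (hqr ▸ hrS) hSu)
        refine ⟨insert i S, Finset.mem_insert_of_mem hrS, Or.inr ?_, ?_⟩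
        · rw [Finset.card_insert_of_notMem hi, Finset.range_add_one, Finset.filter_insert,
            if_pos hqr, Finset.card_insert_of_notMem (by simp)]
          omega
        · intro j' hj' p hp hp'
          rcases Finset.mem_insert.1 hj' with rfl | hj'
          · rw [e] at hp hp'
            have := hu.spread_new ha hδ hb (t := s + τ + q * (L + τ + 1)) (by omega) hw
              (hS j hj _ le_rfl (by omega)) hk he hp hp'
            rw [pow_succ', mul_assoc]
            exact this
          · exact hold j' hj' p hp hp'
      · refine ⟨S, hrS, Or.inr ?_, hold⟩
        rw [Finset.range_add_one, Finset.filter_insert, if_neg hqr]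
        exact hcard
  obtain ⟨S, -, hcard, hS⟩ := key (n * n) le_rfl
  have hSu : S = Finset.univ := by
    rcases hcard with h | h
    · exact h
    · have := (Finset.card_le_univ S).trans_eq (Fintype.card_fin n)
      omega
  intro p hp hp' i
  exact hS i (hSu ▸ Finset.mem_univ i) p hp hp'

/-- Across a good superwindow the range of a trajectory contracts by a fixed factor. -/
theorem IsShiftedTrajectory.contract (hu : IsShiftedTrajectory a u) (ha : IsStochastic δ a)
    (hδ : 0 < δ) (hn : 0 < n) {L s : ℕ} (hg : IsGoodSuperwindow a L (s + τ)) {b c : ℝ}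
    (hb : ∀ p, s ≤ p → ∀ i, b ≤ u p i) (hc : ∀ p, s ≤ p → ∀ i, u p i ≤ c) :
    ∃ t, ∃ b' c' : ℝ, (∀ p, t ≤ p → ∀ i, b' ≤ u p i) ∧ (∀ p, t ≤ p → ∀ i, u p i ≤ c') ∧
      c' - b' ≤ (1 - spreadRate δ n τ L ^ (n * n) * δ ^ τ / 2) * (c - b) := by
  obtain ⟨r, hr⟩ := hg.exists_root hn ha hδ
  set t := s + τ + n * n * (L + τ + 1) with ht
  have hst : s ≤ t := by omega
  have hbc : 0 ≤ (c - b) / 2 := by linarith [hb s le_rfl r, hc s le_rfl r]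
  set ε := spreadRate δ n τ L ^ (n * n) * (δ ^ τ * ((c - b) / 2)) with hε
  have he : (1 - spreadRate δ n τ L ^ (n * n) * δ ^ τ / 2) * (c - b) = c - b - ε := by
    rw [hε]; ring
  rw [he]
  -- A root value in the upper half of `[b, c]` raises the lower bound; one in the lower half lowers
  -- the upper bound, via `-u`. The same `r` serves both, since it does not depend on the
  -- trajectory.
  rcases le_total ((c - b) / 2) (u (s + τ) r - b) with hm | hm
  · refine ⟨t, b + ε, c, ?_, fun p hp => hc p (hst.trans hp), by linarith⟩
    exact hu.lower_bound ha fun p hp hp' i => by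
      linarith [hr u hu b _ hb hbc hm p hp hp' i]
  · refine ⟨t, b, c - ε, fun p hp => hb p (hst.trans hp), ?_, by linarith⟩
    have := hu.neg.lower_bound ha (b := -c + ε) (t := t) fun p hp hp' i => by
      linarith [hr (-u) hu.neg (-c) _ (fun p hp i => neg_le_neg (hc p hp i)) hbc
        (by simp only [Pi.neg_apply]; linarith) p hp hp' i]
    intro p hp i
    have := this p hp i
    simp only [Pi.neg_apply] at this
    linarith

theorem IsShiftedTrajectory.exists_range_le (hu : IsShiftedTrajectory a u) (ha : IsStochastic δ a)
    (hδ : 0 < δ) (hn : 0 < n) {L : ℕ} (hg : ∃ᶠ s in atTop, IsGoodSuperwindow a L s) {d : ℝ}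
    (hd : 0 < d) :
    ∃ t, ∃ b c : ℝ, (∀ p, t ≤ p → ∀ i, b ≤ u p i) ∧ (∀ p, t ≤ p → ∀ i, u p i ≤ c) ∧
      c - b ≤ d := by
  obtain ⟨b₀, hb₀⟩ : ∃ b, ∀ p, 0 ≤ p → ∀ i, b ≤ u p i := by
    obtain ⟨b, hb⟩ := ((Finset.range (τ + 1) ×ˢ Finset.univ).image fun x => u x.1 x.2).bddBelow
    refine ⟨b, hu.lower_bound ha fun p _ hp i => hb ?_⟩
    simp only [Finset.coe_image, Set.mem_image]
    exact ⟨(p, i), by simp; omega, rfl⟩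
  obtain ⟨c₀, hc₀⟩ : ∃ c, ∀ p, 0 ≤ p → ∀ i, u p i ≤ c := by
    obtain ⟨c, hc⟩ := ((Finset.range (τ + 1) ×ˢ Finset.univ).image fun x => u x.1 x.2).bddAbove
    have := hu.neg.lower_bound ha (b := -c) (t := 0) fun p _ hp i => neg_le_neg (hc ?_)
    · exact ⟨c, fun p hp i => neg_le_neg_iff.1 (this p hp i)⟩
    simp only [Finset.coe_image, Set.mem_image]
    exact ⟨(p, i), by simp; omega, rfl⟩
  have hbc : b₀ ≤ c₀ := (hb₀ 0 le_rfl ⟨0, hn⟩).trans (hc₀ 0 le_rfl ⟨0, hn⟩)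
  set ε := spreadRate δ n τ L ^ (n * n) * δ ^ τ / 2 with hε
  have hδ1 := ha.delta_le_one ⟨0, hn⟩
  have hκ0 := spreadRate_pos hδ n τ L
  have hε0 : 0 < ε := by positivity
  have hε1 : ε ≤ 1 := by
    have h1 : spreadRate δ n τ L ^ (n * n) ≤ 1 := pow_le_one₀ hκ0.le
      ((spreadRate_le_pow hδ hδ1 n τ L).trans (pow_le_one₀ hδ.le hδ1))
    have h2 : spreadRate δ n τ L ^ (n * n) * δ ^ τ ≤ 1 :=
      mul_le_one₀ h1 (by positivity) (pow_le_one₀ hδ.le hδ1)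
    rw [hε]; linarith
  have key : ∀ m : ℕ, ∃ t, ∃ b c : ℝ, (∀ p, t ≤ p → ∀ i, b ≤ u p i) ∧
      (∀ p, t ≤ p → ∀ i, u p i ≤ c) ∧ c - b ≤ (1 - ε) ^ m * (c₀ - b₀) := by
    intro m
    induction m with
    | zero => exact ⟨0, b₀, c₀, hb₀, hc₀, by simp⟩
    | succ m ih =>
      obtain ⟨t, b, c, hb, hc, h⟩ := ih
      -- A fresh superwindow exists beyond any time, and its contraction factor is always the same.
      obtain ⟨s, hs, hgs⟩ := frequently_atTop.1 hg (t + τ)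
      obtain ⟨s, rfl⟩ : ∃ s', s = s' + τ := ⟨s - τ, by omega⟩
      obtain ⟨t', b', c', hb', hc', h'⟩ := hu.contract ha hδ hn hgs
        (fun p hp => hb p (by omega)) (fun p hp => hc p (by omega))
      refine ⟨t', b', c', hb', hc', h'.trans ?_⟩
      rw [pow_succ', mul_assoc]
      exact mul_le_mul_of_nonneg_left h (by linarith)
  have hlim : Tendsto (fun m : ℕ => (1 - ε) ^ m * (c₀ - b₀)) atTop (𝓝 0) := by
    simpa using (tendsto_pow_atTop_nhds_zero_of_lt_one (by linarith) (by linarith)).mul_const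
      (c₀ - b₀)
  obtain ⟨m, hm⟩ := (hlim.eventually_le_const hd).exists
  obtain ⟨t, b, c, hb, hc, h⟩ := key m
  exact ⟨t, b, c, hb, hc, h.trans hm⟩

theorem IsStochastic.reachesConsensus (ha : IsStochastic δ a) (hδ : 0 < δ) (hn : 0 < n) {L : ℕ}
    (hg : ∃ᶠ s in atTop, IsGoodSuperwindow a L s) : ReachesConsensus a := by
  intro x hx
  set u : ℕ → Fin n → ℝ := fun p => x ((p : ℤ) - τ) with hu_def
  have hu : IsShiftedTrajectory a u := by
    intro k i
    have e : ((k + τ + 1 : ℕ) : ℤ) - τ = k + 1 := by push_cast; ring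
    simp only [hu_def, e, hx k i]
    refine Finset.sum_congr rfl fun l _ => Finset.sum_congr rfl fun j _ => ?_
    rw [Nat.cast_sub (by omega)]
    congr 2
    push_cast; ring
  have hxu : ∀ k : ℕ, x k = u (k + τ) := fun k => by simp [hu_def]
  have hrange : ∀ d : ℝ, 0 < d → ∃ t, ∀ p, t ≤ p → ∀ q, t ≤ q → ∀ i j, |u p i - u q j| ≤ d := by
    intro d hd
    obtain ⟨t, b, c, hb, hc, h⟩ := hu.exists_range_le ha hδ hn hg hd
    refine ⟨t, fun p hp q hq i j => abs_le.2 ⟨?_, ?_⟩⟩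
    · linarith [hb p hp i, hc q hq j]
    · linarith [hb q hq j, hc p hp i]
  have hcau : CauchySeq fun p => u p ⟨0, hn⟩ := by
    refine Metric.cauchySeq_iff'.2 fun d hd => ?_
    obtain ⟨t, ht⟩ := hrange (d / 2) (by linarith)
    refine ⟨t, fun p hp => ?_⟩
    rw [Real.dist_eq]
    linarith [ht p hp t le_rfl ⟨0, hn⟩ ⟨0, hn⟩]
  obtain ⟨c, hc⟩ := cauchySeq_tendsto_of_complete hcau
  refine ⟨c, fun i => ?_⟩
  have hdiff : Tendsto (fun p => u p i - u p ⟨0, hn⟩) atTop (𝓝 0) := by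
    refine Metric.tendsto_atTop.2 fun d hd => ?_
    obtain ⟨t, ht⟩ := hrange (d / 2) (by linarith)
    refine ⟨t, fun p hp => ?_⟩
    rw [Real.dist_eq, sub_zero]
    linarith [ht p hp p hp i ⟨0, hn⟩]
  have hlim : Tendsto (fun p => u p i) atTop (𝓝 c) := by simpa using hdiff.add hc
  simp only [hxu]
  exact (tendsto_add_atTop_iff_nat τ).2 hlim

end Spread

/-! ### Second-moment estimates under finite-range dependence -/

section SecondMoment

variable {Ω : Type*} [MeasurableSpace Ω] {μ : Measure Ω}

/-- A form of the reverse Fatou lemma. -/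
theorem measure_eventually_le {p : ℕ → Ω → Prop} {ε : ENNReal}
    (h : ∀ s, μ {ω | p s ω} ≤ ε) : μ {ω | ∀ᶠ s in atTop, p s ω} ≤ ε := by
  have e : {ω | ∀ᶠ s in atTop, p s ω} = ⋃ m : ℕ, {ω | ∀ s, m ≤ s → p s ω} := by
    ext ω; simp [eventually_atTop]
  have hmono : Monotone fun m : ℕ => {ω | ∀ s, m ≤ s → p s ω} :=
    fun m m' hmm ω hω s hs => hω s (hmm.trans hs)
  rw [e]
  exact le_of_tendsto (tendsto_measure_iUnion_atTop hmono)
    (Eventually.of_forall fun m =>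
      (measure_mono fun ω (hω : ∀ s, m ≤ s → p s ω) => hω m le_rfl).trans (h m))

variable [IsProbabilityMeasure μ]

/-- Nonnegativity of the variance of `X - Y` bounds twice the covariance by the sum of the
variances. -/
theorem covariance_le_sq_of_bounded {X Y : Ω → ℝ} {C : ℝ} (hX : AEMeasurable X μ)
    (hY : AEMeasurable Y μ) (hXC : ∀ᵐ ω ∂μ, X ω ∈ Set.Icc 0 C)
    (hYC : ∀ᵐ ω ∂μ, Y ω ∈ Set.Icc 0 C) : cov[X, Y; μ] ≤ C ^ 2 := by
  have h1 := variance_le_sq_of_bounded hXC hX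
  have h2 := variance_le_sq_of_bounded hYC hY
  have h3 := variance_sub (memLp_of_bounded hXC hX.aestronglyMeasurable 2)
    (memLp_of_bounded hYC hY.aestronglyMeasurable 2)
  have h4 := variance_nonneg (X - Y) μ
  nlinarith [sq_nonneg C]

/-- The variance of a sum of bounded variables grows at most linearly if those with indices
at distance at least `N` are independent. -/
theorem variance_sum_le {X : ℕ → Ω → ℝ} {C : ℝ} {N : ℕ} (hX : ∀ k, Measurable (X k))
    (hXC : ∀ k, ∀ᵐ ω ∂μ, X k ω ∈ Set.Icc 0 C)
    (hind : ∀ k k', k + N ≤ k' → IndepFun (X k) (X k') μ) (W : Finset ℕ) :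
    Var[∑ k ∈ W, X k; μ] ≤ 2 * N * C ^ 2 * W.card := by
  have hL : ∀ k, MemLp (X k) 2 μ := fun k =>
    memLp_of_bounded (hXC k) (hX k).aestronglyMeasurable 2
  rw [variance_sum' fun k _ => hL k]
  have hrow : ∀ k ∈ W, ∑ k' ∈ W, cov[X k, X k'; μ] ≤ 2 * N * C ^ 2 := by
    intro k _
    -- Only the fewer than `2 * N` indices at distance less than `N` from `k` can contribute; the
    -- rest are uncorrelated with it.
    have h1 : ∀ k' ∈ W, cov[X k, X k'; μ] ≤
        if k' ∈ Finset.Ico (k + 1 - N) (k + N) then C ^ 2 else 0 := by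
      intro k' _
      split_ifs with hk
      · exact covariance_le_sq_of_bounded (hX k).aemeasurable (hX k').aemeasurable (hXC k) (hXC k')
      · rw [Finset.mem_Ico] at hk
        by_cases hlt : k + N ≤ k'
        · exact ((hind k k' hlt).covariance_eq_zero (hL k) (hL k')).le
        · exact ((hind k' k (by omega)).symm.covariance_eq_zero (hL k) (hL k')).le
    refine (Finset.sum_le_sum h1).trans ?_
    rw [← Finset.sum_filter, Finset.sum_const, nsmul_eq_mul]
    gcongr
    have : (W.filter (· ∈ Finset.Ico (k + 1 - N) (k + N))).card ≤ 2 * N := by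
      refine (Finset.card_le_card (t := Finset.Ico (k + 1 - N) (k + N)) fun x hx =>
        (Finset.mem_filter.1 hx).2).trans ?_
      rw [Nat.card_Ico]; omega
    exact_mod_cast this
  refine (Finset.sum_le_sum hrow).trans_eq ?_
  rw [Finset.sum_const, nsmul_eq_mul]; ring

/-- Chebyshev: since the mean is at least `m ≥ 2`, a sum below 1 deviates from it by more than `m -
1 ≥ m / 2`. -/
theorem measure_sum_lt_one_le {X : ℕ → Ω → ℝ} {C : ℝ} {N : ℕ} (hX : ∀ k, Measurable (X k))
    (hXC : ∀ k, ∀ᵐ ω ∂μ, X k ω ∈ Set.Icc 0 C)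
    (hind : ∀ k k', k + N ≤ k' → IndepFun (X k) (X k') μ) (W : Finset ℕ) {m : ℝ} (hm : 2 ≤ m)
    (hE : m ≤ ∑ k ∈ W, ∫ ω, X k ω ∂μ) :
    μ {ω | ∑ k ∈ W, X k ω < 1} ≤ ENNReal.ofReal (2 * N * C ^ 2 * W.card / (m / 2) ^ 2) := by
  have hL : ∀ k, MemLp (X k) 2 μ := fun k =>
    memLp_of_bounded (hXC k) (hX k).aestronglyMeasurable 2
  have hE' : ∫ ω, (∑ k ∈ W, X k) ω ∂μ = ∑ k ∈ W, ∫ ω, X k ω ∂μ := by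
    simp only [Finset.sum_apply]
    exact integral_finsetSum _ fun k _ => (hL k).integrable (by norm_num)
  refine le_trans (measure_mono fun ω hω => ?_) ((meas_ge_le_variance_div_sq
    (memLp_finsetSum' W fun k _ => hL k) (c := m / 2) (by linarith)).trans
      (ENNReal.ofReal_le_ofReal ?_))
  · simp only [Set.mem_ofPred_eq] at hω ⊢
    rw [hE', Finset.sum_apply]
    refine le_trans ?_ (neg_le_abs _)
    linarith
  · gcongr
    exact variance_sum_le hX hXC hind W

end SecondMoment

/-! ### Good windows occur almost surely infinitely often -/

section Windows

variable {Ω : Type*} [MeasurableSpace Ω] {μ : Measure Ω}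
  {A : Fin (τ + 1) → ℕ → Ω → Matrix (Fin n) (Fin n) ℝ} {δ : ℝ}

theorem measurable_cutWeight (hmeas : ∀ l k i j, Measurable fun ω => A l k ω i j)
    (S : Finset (Fin n)) (k : ℕ) : Measurable fun ω => cutWeight (fun l k => A l k ω) S k :=
  Finset.measurable_fun_sum _ fun i _ => Finset.measurable_fun_sum _ fun j _ =>
    Finset.measurable_fun_sum _ fun l _ => hmeas l k i j

theorem IsStochastic.cutWeight_mem_Icc {a : Fin (τ + 1) → ℕ → Matrix (Fin n) (Fin n) ℝ}
    (ha : IsStochastic δ a) (S : Finset (Fin n)) (k : ℕ) :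
    cutWeight a S k ∈ Set.Icc (0 : ℝ) n := by
  constructor
  · exact Finset.sum_nonneg fun i _ => Finset.sum_nonneg fun j _ => Finset.sum_nonneg fun l _ =>
      ha.nonneg l k i j
  · have h1 : ∀ i ∈ Sᶜ, ∑ j ∈ S, ∑ l, a l k i j ≤ 1 := by
      intro i _
      rw [← ha.sum_eq_one k i, Finset.sum_comm]
      exact Finset.sum_le_sum fun l _ => Finset.sum_le_sum_of_subset_of_nonneg
        (Finset.subset_univ S) fun j _ _ => ha.nonneg l k i j
    refine (Finset.sum_le_sum h1).trans ?_
    rw [Finset.sum_const, nsmul_eq_mul, mul_one]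
    exact_mod_cast (Finset.card_le_univ Sᶜ).trans_eq (Fintype.card_fin n)

theorem indepFun_cutWeight {k k' : ℕ}
    (hind : IndepFun (fun ω (l : Fin (τ + 1)) (i j : Fin n) => A l k ω i j)
      (fun ω (l : Fin (τ + 1)) (i j : Fin n) => A l k' ω i j) μ) (S : Finset (Fin n)) :
    IndepFun (fun ω => cutWeight (fun l k => A l k ω) S k)
      (fun ω => cutWeight (fun l k => A l k ω) S k') μ := by
  have hφ : Measurable fun f : Fin (τ + 1) → Fin n → Fin n → ℝ =>
      ∑ i ∈ Sᶜ, ∑ j ∈ S, ∑ l, f l i j := by fun_prop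
  exact hind.comp hφ hφ

variable [IsProbabilityMeasure μ]

theorem integrable_entry (hmeas : ∀ l k i j, Measurable fun ω => A l k ω i j)
    (hA : ∀ᵐ ω ∂μ, IsStochastic δ fun l k => A l k ω) (l : Fin (τ + 1)) (k : ℕ) (i j : Fin n) :
    Integrable (fun ω => A l k ω i j) μ := by
  refine memLp_one_iff_integrable.1 (memLp_of_bounded (a := 0) (b := 1) ?_
    (hmeas l k i j).aestronglyMeasurable 1)
  filter_upwards [hA] with ω ha
  refine ⟨ha.nonneg l k i j, ?_⟩
  rw [← ha.sum_eq_one k i]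
  exact (Finset.single_le_sum (f := fun j => A l k ω i j) (fun j _ => ha.nonneg l k i j)
      (Finset.mem_univ j)).trans
    (Finset.single_le_sum (f := fun l => ∑ j, A l k ω i j)
      (fun l _ => Finset.sum_nonneg fun j _ => ha.nonneg l k i j) (Finset.mem_univ l))

/-- The expected weight of a cut dominates each expected entry across the cut. -/
theorem expectedMatrix_le_integral_cutWeight
    (hmeas : ∀ l k i j, Measurable fun ω => A l k ω i j)
    (hA : ∀ᵐ ω ∂μ, IsStochastic δ fun l k => A l k ω) {S : Finset (Fin n)} {i j : Fin n}
    (hi : i ∉ S) (hj : j ∈ S) (k : ℕ) :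
    expectedMatrix μ (fun ω => totalMatrix (fun l k => A l k ω) k) i j ≤
      ∫ ω, cutWeight (fun l k => A l k ω) S k ∂μ := by
  have hint := integrable_entry hmeas hA
  simp only [expectedMatrix, Matrix.of_apply, totalMatrix, Matrix.sum_apply]
  refine integral_mono_ae (integrable_finsetSum _ fun l _ => hint l k i j)
    (integrable_finsetSum _ fun i _ => integrable_finsetSum _ fun j _ =>
      integrable_finsetSum _ fun l _ => hint l k i j) ?_
  filter_upwards [hA] with ω ha
  have h0 : ∀ i j, 0 ≤ ∑ l, A l k ω i j := fun i j => Finset.sum_nonneg fun l _ => ha.nonneg l k i j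
  exact (Finset.single_le_sum (f := fun j => ∑ l, A l k ω i j) (fun j _ => h0 i j) hj).trans
    (Finset.single_le_sum (f := fun i => ∑ j ∈ S, ∑ l, A l k ω i j)
      (fun i _ => Finset.sum_nonneg fun j _ => h0 i j) (Finset.mem_compl.2 hi))

theorem sum_Ioc_mul (f : ℕ → ℝ) (s h Q : ℕ) :
    ∑ k ∈ Finset.Ioc s (s + Q * h), f k =
      ∑ q ∈ Finset.range Q, ∑ k ∈ Finset.Ioc (s + q * h) (s + q * h + h), f k := by
  induction Q with
  | zero => simp
  | succ Q ih =>
    rw [Finset.sum_range_succ, ← ih, Finset.sum_Ioc_consecutive f (by omega) (by omega)]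
    congr 2
    ring

/-- Long windows have a common vertex whose cuts all have large expected weight. -/
theorem exists_root_expected_cutWeight (hn : 0 < n) (hδ : 0 < δ)
    (hmeas : ∀ l k i j, Measurable fun ω => A l k ω i j)
    (hA : ∀ᵐ ω ∂μ, IsStochastic δ fun l k => A l k ω) {h : ℕ}
    (htree : ∀ m : ℕ, HasDeltaSpanningTree δ (∑ k ∈ Finset.Icc (m + 1) (m + h),
      expectedMatrix μ (fun ω => totalMatrix (fun l k => A l k ω) k))) (R s : ℕ) :
    ∃ r, ∀ S : Finset (Fin n), r ∈ S → S ≠ Finset.univ →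
      R * δ ≤ ∑ k ∈ Finset.Ioc s (s + n * R * h), ∫ ω, cutWeight (fun l k => A l k ω) S k ∂μ := by
  have hroot : ∀ m, ∃ r, ∀ S : Finset (Fin n), r ∈ S → S ≠ Finset.univ →
      δ ≤ ∑ k ∈ Finset.Ioc m (m + h), ∫ ω, cutWeight (fun l k => A l k ω) S k ∂μ := by
    intro m
    obtain ⟨r, hr⟩ := (htree m).exists_root
    refine ⟨r, fun S hrS hS => ?_⟩
    obtain ⟨j, hj, i, hi, hij⟩ := hr S hrS hS
    rw [Matrix.sum_apply, Finset.Icc_add_one_left_eq_Ioc] at hij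
    exact hij.trans (Finset.sum_le_sum fun k _ =>
      expectedMatrix_le_integral_cutWeight hmeas hA hi hj k)
  choose ρ hρ using hroot
  -- Roots vary between blocks of length `h`; among `n * R` blocks some vertex is the root of at
  -- least `R`, each contributing `δ`.
  obtain ⟨r, -, hr⟩ := Finset.exists_le_card_fiber_of_mul_le_card_of_maps_to
    (s := Finset.range (n * R)) (t := Finset.univ) (f := fun q => ρ (s + q * h)) (n := R)
    (fun _ _ => Finset.mem_univ _) ⟨⟨0, hn⟩, Finset.mem_univ _⟩ (by simp)
  refine ⟨r, fun S hrS hS => ?_⟩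
  rw [sum_Ioc_mul]
  have h0 : ∀ k, 0 ≤ ∫ ω, cutWeight (fun l k => A l k ω) S k ∂μ := fun k =>
    integral_nonneg_of_ae (hA.mono fun ω ha => (ha.cutWeight_mem_Icc S k).1)
  calc (R : ℝ) * δ ≤
        (((Finset.range (n * R)).filter fun q => ρ (s + q * h) = r).card : ℝ) * δ := by
        gcongr
    _ = ∑ q ∈ (Finset.range (n * R)).filter (fun q => ρ (s + q * h) = r), δ := by
        rw [Finset.sum_const, nsmul_eq_mul]
    _ ≤ ∑ q ∈ (Finset.range (n * R)).filter (fun q => ρ (s + q * h) = r),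
          ∑ k ∈ Finset.Ioc (s + q * h) (s + q * h + h),
            ∫ ω, cutWeight (fun l k => A l k ω) S k ∂μ := by
        refine Finset.sum_le_sum fun q hq => hρ _ S ?_ hS
        rw [(Finset.mem_filter.1 hq).2]
        exact hrS
    _ ≤ _ := Finset.sum_le_sum_of_subset_of_nonneg (Finset.filter_subset _ _)
        fun q _ _ => Finset.sum_nonneg fun k _ => h0 k

/-- Sufficiently long windows are good with probability close to one. -/
theorem exists_measure_not_isGoodWindow_le (hn : 0 < n) (hδ : 0 < δ)
    (hmeas : ∀ l k i j, Measurable fun ω => A l k ω i j)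
    (hA : ∀ᵐ ω ∂μ, IsStochastic δ fun l k => A l k ω) {h N : ℕ}
    (hindep : ∀ k k' : ℕ, k + N ≤ k' →
      IndepFun (fun ω (l : Fin (τ + 1)) (i j : Fin n) => A l k ω i j)
        (fun ω (l : Fin (τ + 1)) (i j : Fin n) => A l k' ω i j) μ)
    (htree : ∀ m : ℕ, HasDeltaSpanningTree δ (∑ k ∈ Finset.Icc (m + 1) (m + h),
      expectedMatrix μ (fun ω => totalMatrix (fun l k => A l k ω) k)))
    {ε : ℝ} (hε : 0 < ε) :
    ∃ L, ∀ s, μ {ω | ¬ IsGoodWindow (fun l k => A l k ω) s (s + L)} ≤ ENNReal.ofReal ε := by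
  -- The first term makes the mean at least 2. The second makes the Chebyshev bound `8 * N * n ^ 3 *
  -- h / (R * δ ^ 2)` at most `ε` divided by the number of vertex sets, ready for the union bound.
  obtain ⟨R, hR⟩ := exists_nat_ge
    (max (2 / δ) (8 * N * n ^ 3 * h * (Fintype.card (Finset (Fin n))) / (δ ^ 2 * ε)))
  have hR1 : 2 ≤ R * δ := (div_le_iff₀ hδ).1 ((le_max_left _ _).trans hR)
  have hR2 := (div_le_iff₀ (by positivity)).1 ((le_max_right _ _).trans hR)
  have hR0 : (0 : ℝ) < R := by
    by_contra hneg
    nlinarith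
  set Q := Fintype.card (Finset (Fin n)) with hQ
  have hQ0 : (0 : ℝ) < Q := by exact_mod_cast Fintype.card_pos
  refine ⟨n * R * h, fun s => ?_⟩
  obtain ⟨r, hr⟩ := exists_root_expected_cutWeight hn hδ hmeas hA htree R s
  set bad : Finset (Fin n) → Set Ω := fun S =>
    {ω | ∑ k ∈ Finset.Ioc s (s + n * R * h), cutWeight (fun l k => A l k ω) S k < 1} with hbad
  have hcut : ∀ S, r ∈ S → S ≠ Finset.univ → μ (bad S) ≤ ENNReal.ofReal (ε / Q) := by
    intro S hrS hS
    refine (measure_sum_lt_one_le (measurable_cutWeight hmeas S)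
      (fun k => hA.mono fun ω ha => ha.cutWeight_mem_Icc S k)
      (fun k k' hk => indepFun_cutWeight (hindep k k' hk) S) _ hR1 (hr S hrS hS)).trans
      (ENNReal.ofReal_le_ofReal ?_)
    rw [Nat.card_Ioc, Nat.add_sub_cancel_left, div_le_div_iff₀ (by positivity) hQ0]
    push_cast
    have := mul_le_mul_of_nonneg_left hR2 hR0.le
    nlinarith
  calc μ {ω | ¬ IsGoodWindow (fun l k => A l k ω) s (s + n * R * h)}
      ≤ μ (⋃ S ∈ Finset.univ.filter (fun S : Finset (Fin n) => r ∈ S ∧ S ≠ Finset.univ), bad S) := by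
        refine measure_mono fun ω hω => ?_
        by_contra hcon
        refine hω ⟨r, fun S hrS hS => ?_⟩
        by_contra hlt
        exact hcon (Set.mem_biUnion (by simp [hrS, hS]) (not_le.1 hlt))
    _ ≤ ∑ S ∈ Finset.univ.filter (fun S : Finset (Fin n) => r ∈ S ∧ S ≠ Finset.univ), μ (bad S) :=
        measure_biUnion_finset_le _ _
    _ ≤ ∑ S ∈ Finset.univ.filter (fun S : Finset (Fin n) => r ∈ S ∧ S ≠ Finset.univ),
          ENNReal.ofReal (ε / Q) := by
        refine Finset.sum_le_sum fun S hS => ?_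
        obtain ⟨-, h1, h2⟩ := Finset.mem_filter.1 hS
        exact hcut S h1 h2
    _ ≤ ∑ S : Finset (Fin n), ENNReal.ofReal (ε / Q) :=
        Finset.sum_le_sum_of_subset (Finset.filter_subset _ _)
    _ = ENNReal.ofReal ε := by
        rw [Finset.sum_const, Finset.card_univ, ← hQ, nsmul_eq_mul, ← ENNReal.ofReal_natCast,
          ← ENNReal.ofReal_mul hQ0.le]
        congr 1
        field_simp

/-- Almost surely, for some length, there are infinitely many good superwindows. -/
theorem ae_frequently_isGoodSuperwindow (hn : 0 < n) (hδ : 0 < δ)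
    (hmeas : ∀ l k i j, Measurable fun ω => A l k ω i j)
    (hA : ∀ᵐ ω ∂μ, IsStochastic δ fun l k => A l k ω) {h N : ℕ}
    (hindep : ∀ k k' : ℕ, k + N ≤ k' →
      IndepFun (fun ω (l : Fin (τ + 1)) (i j : Fin n) => A l k ω i j)
        (fun ω (l : Fin (τ + 1)) (i j : Fin n) => A l k' ω i j) μ)
    (htree : ∀ m : ℕ, HasDeltaSpanningTree δ (∑ k ∈ Finset.Icc (m + 1) (m + h),
      expectedMatrix μ (fun ω => totalMatrix (fun l k => A l k ω) k))) :
    ∀ᵐ ω ∂μ, ∃ L, ∃ᶠ s in atTop, IsGoodSuperwindow (fun l k => A l k ω) L s := by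
  have hn' : (0 : ℝ) < n * n := by positivity
  -- The length `L` depends on `ε`, but the event that no length works does not, so its measure is
  -- below every `ε`.
  have key : ∀ ε : ℝ, 0 < ε → μ {ω | ¬ ∃ L, ∃ᶠ s in atTop,
      IsGoodSuperwindow (fun l k => A l k ω) L s} ≤ ENNReal.ofReal ε := by
    intro ε hε
    obtain ⟨L, hL⟩ := exists_measure_not_isGoodWindow_le hn hδ hmeas hA hindep htree
      (ε := ε / (n * n)) (by positivity)
    refine le_trans (measure_mono fun ω hω => ?_) (measure_eventually_le
      (p := fun s ω => ¬ IsGoodSuperwindow (fun l k => A l k ω) L s) fun s => ?_)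
    · exact not_frequently.1 fun hf => hω ⟨L, hf⟩
    -- A union bound over the `n * n` windows suffices; no independence between windows is needed.
    calc μ {ω | ¬ IsGoodSuperwindow (fun l k => A l k ω) L s}
        ≤ μ (⋃ q ∈ Finset.range (n * n), {ω | ¬ IsGoodWindow (fun l k => A l k ω)
            (s + q * (L + τ + 1)) (s + q * (L + τ + 1) + L)}) := by
          refine measure_mono fun ω hω => ?_
          simp only [IsGoodSuperwindow, Set.mem_ofPred_eq, not_forall] at hω
          obtain ⟨q, hq, hbad⟩ := hω
          exact Set.mem_biUnion (Finset.mem_coe.2 (Finset.mem_range.2 hq)) hbad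
      _ ≤ ∑ q ∈ Finset.range (n * n), μ {ω | ¬ IsGoodWindow (fun l k => A l k ω)
            (s + q * (L + τ + 1)) (s + q * (L + τ + 1) + L)} := measure_biUnion_finset_le _ _
      _ ≤ ∑ q ∈ Finset.range (n * n), ENNReal.ofReal (ε / (n * n)) :=
          Finset.sum_le_sum fun q _ => hL _
      _ = ENNReal.ofReal ε := by
          rw [Finset.sum_const, Finset.card_range, nsmul_eq_mul, ← ENNReal.ofReal_natCast,
            ← ENNReal.ofReal_mul (by positivity)]
          congr 1
          push_cast
          field_simp
  rw [ae_iff]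
  refine le_antisymm (ENNReal.le_of_forall_pos_le_add fun ε hε _ => ?_) zero_le
  rw [zero_add, ← ENNReal.ofReal_coe_nnreal]
  exact key ε hε

end Windows

end DelayedConsensus

theorem mainTheorem8 {Ω : Type*} [MeasurableSpace Ω] (μ : Measure Ω) [IsProbabilityMeasure μ]
    (n τ : ℕ)
    -- `A l k ω` is the matrix `A^l(k)` at the sample point `ω`
    (A : Fin (τ + 1) → ℕ → Ω → Matrix (Fin n) (Fin n) ℝ)
    (hmeas : ∀ l k i j, Measurable fun ω => A l k ω i j)
    -- standing assumptions on the coefficients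
    (hnonneg : ∀ l k i j, ∀ᵐ ω ∂μ, 0 ≤ A l k ω i j)
    (hsum : ∀ k i, ∀ᵐ ω ∂μ, ∑ l, ∑ j, A l k ω i j = 1)
    -- `A^0(k) ≥ δ I` entrywise, and no self-delays
    (δ : ℝ) (hδ : 0 < δ)
    (hdiag : ∀ k i j, ∀ᵐ ω ∂μ, (δ • (1 : Matrix (Fin n) (Fin n) ℝ)) i j ≤ A 0 k ω i j)
    (hself : ∀ l, l ≠ 0 → ∀ k j, ∀ᵐ ω ∂μ, A l k ω j j = 0)
    -- the coefficients at times `k` and `k'` are independent whenever `k' ≥ k + N`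
    (N : ℕ) (hN : 0 < N)
    (hindep : ∀ k k' : ℕ, k + N ≤ k' →
      IndepFun (fun ω (l : Fin (τ + 1)) (i j : Fin n) => A l k ω i j)
        (fun ω (l : Fin (τ + 1)) (i j : Fin n) => A l k' ω i j) μ)
    -- every window of length `h` of the expected matrices has a `δ`-spanning tree
    (h : ℕ) (hh : 0 < h)
    (htree : ∀ m : ℕ, DelayedConsensus.HasDeltaSpanningTree δ
      (∑ k ∈ Finset.Icc (m + 1) (m + h), DelayedConsensus.expectedMatrix μ
        (fun ω => DelayedConsensus.totalMatrix (fun l k => A l k ω) k))) :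
    ∀ᵐ ω ∂μ, DelayedConsensus.ReachesConsensus (fun l k => A l k ω) := by
  -- The root of a spanning tree is a vertex, which excludes `n = 0`.
  have hn : 0 < n := by
    obtain ⟨_, -, r, -⟩ := htree 0
    exact r.pos
  have hA : ∀ᵐ ω ∂μ, DelayedConsensus.IsStochastic δ fun l k => A l k ω := by
    have h1 : ∀ᵐ ω ∂μ, ∀ l k i j, 0 ≤ A l k ω i j := by simpa only [ae_all_iff] using hnonneg
    have h2 : ∀ᵐ ω ∂μ, ∀ k i, ∑ l, ∑ j, A l k ω i j = 1 := by simpa only [ae_all_iff] using hsum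
    have h3 : ∀ᵐ ω ∂μ, ∀ k i, (δ • (1 : Matrix (Fin n) (Fin n) ℝ)) i i ≤ A 0 k ω i i := by
      simp only [ae_all_iff]
      exact fun k i => hdiag k i i
    filter_upwards [h1, h2, h3] with ω h1 h2 h3
    exact ⟨h1, h2, fun k i => by simpa using h3 k i⟩
  filter_upwards [hA, DelayedConsensus.ae_frequently_isGoodSuperwindow hn hδ hmeas hA hindep htree]
    with ω ha ⟨L, hL⟩
  exact ha.reachesConsensus hδ hn hL
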